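/- All manifolds, metrics, tensor fields and maps are smooth ($C^\infty$), and manifolds are finite-dimensional without boundary. An almost product structure on $M$ is a $(1,1)$-tensor field $P$ with $P^2=I$. Let $h$ be a semi-Riemannian metric on $M$ with Levi-Civita connection $\nabla$. The triple $(M,h,P)$ is called * almost para-Hermitian if $h(PX,Y)=-h(X,PY)$ for all $X,Y$; * semi para-Kähler if it is almost para-Hermitian and $\operatorname{div}P:=\sum_{i,j}h^{ij}(\nabla_{e_i}P)e_j=0$, where $(e_i)$ is any local frame of $TM$ and $(h^{ij})=(h(e_i,e_j))^{-1}$; * quasi para-Kähler if it is almost para-Hermitian and $S_P(X,Y):=(\nabla_XP)Y+P\big((\nabla_{PX}P)Y\big)=0$ for all $X,Y$; * almost product Riemannian if $h$ is Riemannian and $h(PX,Y)=h(X,PY)$ for all $X,Y$; * locally decomposable product Riemannian if it is almost product Riemannian, $P$ is integrable, i.e. $P^2[X,Y]+[PX,PY]-P[PX,Y]-P[X,PY]=0$ for all $X,Y$, and $$(\Psi_Ph)(X,Y,Z)=(\Psi_Ph)(Y,X,Z)+(\Psi_Ph)(PY,PX,Z)\qquad\text{for all }X,Y,Z,$$ where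 $(\Psi_Ph)(X,Y,Z)=(\phi_Ph)(X,Y,Z)+(\phi_Ph)(Z,Y,X)$ and $(\phi_Ph)(X,Y,Z)=(PX)\big(h(Y,Z)\big)-X\big(h(PY,Z)\big)+h\big((\mathcal L_YP)X,Z\big)+h\big(Y,(\mathcal L_ZP)X\big)$ (equivalently, it is almost product Riemannian and $\nabla P=0$). Let $(N,g,Q)$ be a second such triple. A smooth map $F:M\to N$ is $\pm(P,Q)$-paraholomorphic if either $F_*\circ P=Q\circ F_*$ or $F_*\circ P=-Q\circ F_*$. It is harmonic if its tension field $\sum_{i,j}h^{ij}(\nabla F_*)(e_i,e_j)$ vanishes, where $(\nabla F_*)(X,Y)=\nabla^N_{F_*X}(F_*Y)-F_*(\nabla^M_XY)$ is the second fundamental form of $F$. **Theorem.** Let $F:(M,h,P)\to(N,g,Q)$ be a $\pm(P,Q)$-paraholomorphic map. Suppose that $(M,h,P)$ is a semi para-Kähler manifold and that $(N,g,Q)$ is either a quasi para-Kähler manifold or a locally decomposable product Riemannian manifold. Then $F$ is harmonic. -/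

import Mathlib

open Bundle VectorField
open scoped Manifold ContDiff

set_option linter.unusedSectionVars false

noncomputable section ParaGeometry

variable {E : Type*} [NormedAddCommGroup E] [NormedSpace ℝ E] [FiniteDimensional ℝ E]
  {M : Type*} [TopologicalSpace M] [ChartedSpace E M] [IsManifold 𝓘(ℝ, E) ∞ M]

variable (E M) in
/-- A smooth semi-Riemannian metric: a smooth field of nondegenerate symmetric bilinear forms on the
tangent spaces. -/
structure SemiRiemannianMetric where
  inner (x : M) : TangentSpace 𝓘(ℝ, E) x →L[ℝ] TangentSpace 𝓘(ℝ, E) x →L[ℝ] ℝ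
  symm (x : M) (u v : TangentSpace 𝓘(ℝ, E) x) : inner x u v = inner x v u
  nondegenerate (x : M) (u : TangentSpace 𝓘(ℝ, E) x) : (∀ v, inner x u v = 0) → u = 0
  contMDiff : ContMDiff 𝓘(ℝ, E) (𝓘(ℝ, E).prod 𝓘(ℝ, E →L[ℝ] E →L[ℝ] ℝ)) ∞
    (fun x ↦ TotalSpace.mk' (E →L[ℝ] E →L[ℝ] ℝ)
      (E := fun x : M ↦ TangentSpace 𝓘(ℝ, E) x →L[ℝ] TangentSpace 𝓘(ℝ, E) x →L[ℝ] ℝ) x (inner x))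

namespace SemiRiemannianMetric

variable (h : SemiRiemannianMetric E M)

theorem mdifferentiableAt_inner {X Y : Π x : M, TangentSpace 𝓘(ℝ, E) x} {x : M}
    (hX : MDiffAt (T% X) x) (hY : MDiffAt (T% Y) x) :
    MDifferentiableAt 𝓘(ℝ, E) 𝓘(ℝ, ℝ) (fun y ↦ h.inner y (X y) (Y y)) x := by
  have : MDifferentiableAt 𝓘(ℝ, E) (𝓘(ℝ, E).prod 𝓘(ℝ))
      (fun m ↦ TotalSpace.mk' ℝ (E := Bundle.Trivial M ℝ) m (h.inner m (X m) (Y m))) x := by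
    apply MDifferentiableAt.clm_bundle_apply₂ (F₁ := E) (F₂ := E)
    · exact h.contMDiff.mdifferentiableAt (by simp)
    · exact hX
    · exact hY
  simp only [mdifferentiableAt_totalSpace] at this
  exact this.2

/-- The right-hand side of Koszul's formula for `2 h(∇_X Y, Z)`. -/
def koszul (X Y Z : Π x : M, TangentSpace 𝓘(ℝ, E) x) (x : M) : ℝ :=
  mvfderiv 𝓘(ℝ, E) (fun y ↦ h.inner y (Y y) (Z y)) x (X x)
    + mvfderiv 𝓘(ℝ, E) (fun y ↦ h.inner y (X y) (Z y)) x (Y x)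
    - mvfderiv 𝓘(ℝ, E) (fun y ↦ h.inner y (X y) (Y y)) x (Z x)
    + h.inner x (mlieBracket 𝓘(ℝ, E) X Y x) (Z x)
    - h.inner x (mlieBracket 𝓘(ℝ, E) X Z x) (Y x)
    - h.inner x (mlieBracket 𝓘(ℝ, E) Y Z x) (X x)

section

variable {f : M → ℝ} {X X' Y Z : Π x : M, TangentSpace 𝓘(ℝ, E) x} {x : M}

theorem mvfderiv_inner_add_left (hX : MDiffAt (T% X) x) (hX' : MDiffAt (T% X') x)
    (hY : MDiffAt (T% Y) x) :
    mvfderiv 𝓘(ℝ, E) (fun y ↦ h.inner y ((X + X') y) (Y y)) x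
      = mvfderiv 𝓘(ℝ, E) (fun y ↦ h.inner y (X y) (Y y)) x
        + mvfderiv 𝓘(ℝ, E) (fun y ↦ h.inner y (X' y) (Y y)) x := by
  rw [← mvfderiv_add (h.mdifferentiableAt_inner hX hY) (h.mdifferentiableAt_inner hX' hY)]
  congr 1
  funext y
  simp

theorem mvfderiv_inner_smul_left (hf : MDiffAt f x) (hX : MDiffAt (T% X) x)
    (hY : MDiffAt (T% Y) x) :
    mvfderiv 𝓘(ℝ, E) (fun y ↦ h.inner y ((f • X) y) (Y y)) x
      = f x • mvfderiv 𝓘(ℝ, E) (fun y ↦ h.inner y (X y) (Y y)) x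
        + h.inner x (X x) (Y x) • mvfderiv 𝓘(ℝ, E) f x := by
  have := mvfderiv_mul hf (h.mdifferentiableAt_inner hX hY)
  rw [← this]
  congr 1
  funext y
  simp

theorem mvfderiv_inner_comm (X Y : Π x : M, TangentSpace 𝓘(ℝ, E) x) :
    (fun y ↦ h.inner y (X y) (Y y)) = fun y ↦ h.inner y (Y y) (X y) :=
  funext fun y ↦ h.symm y _ _

theorem koszul_tensorial_left (hY : MDiffAt (T% Y) x) (hZ : MDiffAt (T% Z) x) :
    TensorialAt 𝓘(ℝ, E) E (fun X ↦ h.koszul X Y Z x) x where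
  smul hf hX := by
    simp only [koszul, h.mvfderiv_inner_smul_left hf hX hY, h.mvfderiv_inner_smul_left hf hX hZ,
      mlieBracket_smul_left hf hX]
    simp
    ring
  add hX hX' := by
    simp only [koszul, h.mvfderiv_inner_add_left hX hX' hY, h.mvfderiv_inner_add_left hX hX' hZ,
      mlieBracket_add_left hX hX']
    simp
    ring

theorem koszul_tensorial_right (hX : MDiffAt (T% X) x) (hY : MDiffAt (T% Y) x) :
    TensorialAt 𝓘(ℝ, E) E (fun Z ↦ h.koszul X Y Z x) x where
  smul {f Z} hf hZ := by
    simp only [koszul, h.mvfderiv_inner_comm _ (f • Z), h.mvfderiv_inner_smul_left hf hZ hX,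
      h.mvfderiv_inner_smul_left hf hZ hY, mlieBracket_smul_right hf hZ]
    simp only [h.mvfderiv_inner_comm Z]
    simp [h.symm x (Z x)]
    ring
  add {Z Z'} hZ hZ' := by
    simp only [koszul, h.mvfderiv_inner_comm _ (Z + Z'), h.mvfderiv_inner_add_left hZ hZ' hX,
      h.mvfderiv_inner_add_left hZ hZ' hY, mlieBracket_add_right hZ hZ']
    simp only [h.mvfderiv_inner_comm Z, h.mvfderiv_inner_comm Z']
    simp
    ring

theorem koszul_add_middle {Y' : Π x : M, TangentSpace 𝓘(ℝ, E) x} (hX : MDiffAt (T% X) x)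
    (hY : MDiffAt (T% Y) x) (hY' : MDiffAt (T% Y') x) (hZ : MDiffAt (T% Z) x) :
    h.koszul X (Y + Y') Z x = h.koszul X Y Z x + h.koszul X Y' Z x := by
  simp only [koszul, h.mvfderiv_inner_comm X (Y + Y'), h.mvfderiv_inner_add_left hY hY' hX,
    h.mvfderiv_inner_add_left hY hY' hZ, mlieBracket_add_right hY hY', mlieBracket_add_left hY hY']
  simp only [h.mvfderiv_inner_comm X Y, h.mvfderiv_inner_comm X Y']
  simp
  ring

theorem koszul_smul_middle (hX : MDiffAt (T% X) x) (hf : MDiffAt f x)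
    (hY : MDiffAt (T% Y) x) (hZ : MDiffAt (T% Z) x) :
    h.koszul X (f • Y) Z x
      = f x * h.koszul X Y Z x + 2 * (mvfderiv 𝓘(ℝ, E) f x (X x) * h.inner x (Y x) (Z x)) := by
  simp only [koszul, h.mvfderiv_inner_comm X (f • Y), h.mvfderiv_inner_smul_left hf hY hX,
    h.mvfderiv_inner_smul_left hf hY hZ, mlieBracket_smul_right hf hY, mlieBracket_smul_left hf hY]
  simp only [h.mvfderiv_inner_comm X Y]
  simp
  ring

theorem koszul_add_swap :
    h.koszul X Y Z x + h.koszul X Z Y x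
      = 2 * mvfderiv 𝓘(ℝ, E) (fun y ↦ h.inner y (Y y) (Z y)) x (X x) := by
  simp only [koszul, h.mvfderiv_inner_comm Z Y, mlieBracket_swap_apply (V := Z) (W := Y)]
  simp
  ring

theorem koszul_sub_swap :
    h.koszul X Y Z x - h.koszul Y X Z x
      = 2 * h.inner x (mlieBracket 𝓘(ℝ, E) X Y x) (Z x) := by
  simp only [koszul, h.mvfderiv_inner_comm Y X, mlieBracket_swap_apply (V := Y) (W := X)]
  simp
  ring

end

/-- The isomorphism `T_xM ≃ T_x^*M`, `u ↦ h(u, ·)`. -/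
def flat (x : M) : TangentSpace 𝓘(ℝ, E) x ≃ₗ[ℝ] (TangentSpace 𝓘(ℝ, E) x →L[ℝ] ℝ) :=
  have : FiniteDimensional ℝ (TangentSpace 𝓘(ℝ, E) x) := inferInstanceAs (FiniteDimensional ℝ E)
  have : T2Space (TangentSpace 𝓘(ℝ, E) x) := inferInstanceAs (T2Space E)
  have : FiniteDimensional ℝ (TangentSpace 𝓘(ℝ, E) x →L[ℝ] ℝ) :=
    LinearMap.toContinuousLinearMap.finiteDimensional
  LinearMap.linearEquivOfInjective (h.inner x).toLinearMap
    ((injective_iff_map_eq_zero _).2 fun u hu ↦ h.nondegenerate x u fun v ↦ by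
      simpa using DFunLike.congr_fun hu v)
    ((Subspace.dual_finrank_eq (K := ℝ) (V := TangentSpace 𝓘(ℝ, E) x)).symm.trans
      LinearMap.toContinuousLinearMap.finrank_eq)

theorem flat_apply (x : M) (u v : TangentSpace 𝓘(ℝ, E) x) : h.flat x u v = h.inner x u v := rfl

theorem inner_flat_symm (x : M) (l : TangentSpace 𝓘(ℝ, E) x →L[ℝ] ℝ)
    (v : TangentSpace 𝓘(ℝ, E) x) : h.inner x ((h.flat x).symm l) v = l v := by
  rw [← flat_apply, LinearEquiv.apply_symm_apply]

theorem ext_inner {x : M} {u u' : TangentSpace 𝓘(ℝ, E) x}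
    (H : ∀ v, h.inner x u v = h.inner x u' v) : u = u' :=
  sub_eq_zero.1 <| h.nondegenerate x _ fun v ↦ by simp [H v]

open Classical in
/-- The underlying map of the Levi-Civita connection: for a vector field `Y` differentiable at `x`,
`∇_u Y` is the vector determined by Koszul's formula (and by convention it is `0` if `Y` is not
differentiable at `x`). -/
def leviCivitaFun (Y : Π x : M, TangentSpace 𝓘(ℝ, E) x) (x : M) :
    TangentSpace 𝓘(ℝ, E) x →L[ℝ] TangentSpace 𝓘(ℝ, E) x :=
  have : FiniteDimensional ℝ (TangentSpace 𝓘(ℝ, E) x) := inferInstanceAs (FiniteDimensional ℝ E)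
  have : T2Space (TangentSpace 𝓘(ℝ, E) x) := inferInstanceAs (T2Space E)
  if hY : MDiffAt (T% Y) x then
    LinearMap.toContinuousLinearMap <| (h.flat x).symm.toLinearMap ∘ₗ
      ((1 / 2 : ℝ) • TensorialAt.mkHom₂ (fun X Z ↦ h.koszul X Y Z x) x
        (fun _ hZ ↦ h.koszul_tensorial_left hY hZ)
        (fun _ hX ↦ h.koszul_tensorial_right hX hY)).toLinearMap
  else 0

theorem two_mul_inner_leviCivitaFun {X Y Z : Π x : M, TangentSpace 𝓘(ℝ, E) x} {x : M}
    (hX : MDiffAt (T% X) x) (hY : MDiffAt (T% Y) x) (hZ : MDiffAt (T% Z) x) :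
    2 * h.inner x (h.leviCivitaFun Y x (X x)) (Z x) = h.koszul X Y Z x := by
  have := TensorialAt.mkHom₂_apply (Φ := fun X Z ↦ h.koszul X Y Z x)
        (fun _ hZ ↦ h.koszul_tensorial_left hY hZ)
        (fun _ hX ↦ h.koszul_tensorial_right hX hY) hX hZ
  simp only [leviCivitaFun, dif_pos hY]
  simp [inner_flat_symm, this]

/-- The Levi-Civita connection of a semi-Riemannian metric. -/
def leviCivita : CovariantDerivative 𝓘(ℝ, E) E (TangentSpace 𝓘(ℝ, E) : M → Type _) where
  toFun := h.leviCivitaFun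
  isCovariantDerivativeOnUniv :=
    { add := fun {Y Y' x} hY hY' _ ↦ by
        ext u
        refine h.ext_inner fun w ↦ ?_
        have hu := FiberBundle.mdifferentiableAt_extend 𝓘(ℝ, E) E u
        have hw := FiberBundle.mdifferentiableAt_extend 𝓘(ℝ, E) E w
        have e1 := h.two_mul_inner_leviCivitaFun hu hY hw
        have e2 := h.two_mul_inner_leviCivitaFun hu hY' hw
        have e3 := h.two_mul_inner_leviCivitaFun hu (mdifferentiableAt_add_section hY hY') hw
        rw [h.koszul_add_middle hu hY hY' hw] at e3
        simp only [FiberBundle.extend_apply_self] at e1 e2 e3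
        simp only [add_apply, map_add]
        linarith
      leibniz := fun {Y f x} hY hf _ ↦ by
        ext u
        refine h.ext_inner fun w ↦ ?_
        have hu := FiberBundle.mdifferentiableAt_extend 𝓘(ℝ, E) E u
        have hw := FiberBundle.mdifferentiableAt_extend 𝓘(ℝ, E) E w
        have e1 := h.two_mul_inner_leviCivitaFun hu hY hw
        have e3 := h.two_mul_inner_leviCivitaFun hu (hf.smul_section hY) hw
        rw [h.koszul_smul_middle hu hf hY hw] at e3
        simp only [FiberBundle.extend_apply_self] at e1 e3
        simp
        linear_combination (1 / 2) * e3 - (f x / 2) * e1 }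

theorem two_mul_inner_leviCivita {X Y Z : Π x : M, TangentSpace 𝓘(ℝ, E) x} {x : M}
    (hX : MDiffAt (T% X) x) (hY : MDiffAt (T% Y) x) (hZ : MDiffAt (T% Z) x) :
    2 * h.inner x (h.leviCivita Y x (X x)) (Z x) = h.koszul X Y Z x :=
  h.two_mul_inner_leviCivitaFun hX hY hZ

/-- The Levi-Civita connection is compatible with the metric. -/
theorem leviCivita_metric {X Y Z : Π x : M, TangentSpace 𝓘(ℝ, E) x} {x : M}
    (hX : MDiffAt (T% X) x) (hY : MDiffAt (T% Y) x) (hZ : MDiffAt (T% Z) x) :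
    mvfderiv 𝓘(ℝ, E) (fun y ↦ h.inner y (Y y) (Z y)) x (X x)
      = h.inner x (h.leviCivita Y x (X x)) (Z x) + h.inner x (Y x) (h.leviCivita Z x (X x)) := by
  have e1 := h.two_mul_inner_leviCivita hX hY hZ
  have e2 := h.two_mul_inner_leviCivita hX hZ hY
  have e3 := h.koszul_add_swap (X := X) (Y := Y) (Z := Z) (x := x)
  rw [h.symm x (Y x)]
  linarith

/-- The Levi-Civita connection is torsion-free. -/
theorem leviCivita_torsion : h.leviCivita.torsion = 0 := by
  rw [CovariantDerivative.torsion_eq_zero_iff]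
  intro X Y x hX hY
  refine h.ext_inner fun w ↦ ?_
  have hw := FiberBundle.mdifferentiableAt_extend 𝓘(ℝ, E) E w
  have e1 := h.two_mul_inner_leviCivita hX hY hw
  have e2 := h.two_mul_inner_leviCivita hY hX hw
  have e3 := h.koszul_sub_swap (X := X) (Y := Y) (Z := FiberBundle.extend E w) (x := x)
  simp only [FiberBundle.extend_apply_self] at e1 e2 e3
  simp
  linarith

/-- The trace of a bilinear map `B` on `T_xM` with respect to the metric: `∑ h^{ij} B(e_i, e_j)`,
where `(e_i)` is a basis of `T_xM` and `(h^{ij})` is the inverse of the matrix `h(e_i, e_j)`. -/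
def trace {W : Type*} [AddCommGroup W] [Module ℝ W] (x : M)
    (B : TangentSpace 𝓘(ℝ, E) x → TangentSpace 𝓘(ℝ, E) x → W) : W :=
  let e : Module.Basis (Fin (Module.finrank ℝ E)) ℝ (TangentSpace 𝓘(ℝ, E) x) :=
    Module.finBasis ℝ E
  ∑ i, ∑ j, (Matrix.of fun i j ↦ h.inner x (e i) (e j))⁻¹ i j • B (e i) (e j)

/-- The metric is positive definite. -/
def IsRiemannian : Prop := ∀ (x : M) (u : TangentSpace 𝓘(ℝ, E) x), u ≠ 0 → 0 < h.inner x u u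

end SemiRiemannianMetric

variable (E M) in
/-- An almost product structure: a smooth `(1,1)`-tensor field `P` with `P² = I`. -/
structure AlmostProductStructure where
  toEnd (x : M) : TangentSpace 𝓘(ℝ, E) x →L[ℝ] TangentSpace 𝓘(ℝ, E) x
  toEnd_toEnd (x : M) (u : TangentSpace 𝓘(ℝ, E) x) : toEnd x (toEnd x u) = u
  contMDiff : ContMDiff 𝓘(ℝ, E) (𝓘(ℝ, E).prod 𝓘(ℝ, E →L[ℝ] E)) ∞
    (fun x ↦ TotalSpace.mk' (E →L[ℝ] E)
      (E := fun x : M ↦ TangentSpace 𝓘(ℝ, E) x →L[ℝ] TangentSpace 𝓘(ℝ, E) x) x (toEnd x))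

namespace AlmostProductStructure

variable (P : AlmostProductStructure E M) (h : SemiRiemannianMetric E M)

/-- The vector field `PX`. -/
def app (X : Π x : M, TangentSpace 𝓘(ℝ, E) x) : Π x : M, TangentSpace 𝓘(ℝ, E) x :=
  fun x ↦ P.toEnd x (X x)

theorem mdifferentiableAt_app {X : Π x : M, TangentSpace 𝓘(ℝ, E) x} {x : M}
    (hX : MDiffAt (T% X) x) : MDiffAt (T% (P.app X)) x :=
  MDifferentiableAt.clm_bundle_apply (F₁ := E) (F₂ := E)
    (P.contMDiff.mdifferentiableAt (by simp)) hX

/-- The Nijenhuis tensor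
`N_P(X, Y) = P²[X, Y] + [PX, PY] - P[PX, Y] - P[X, PY]`. -/
def nijenhuis (X Y : Π x : M, TangentSpace 𝓘(ℝ, E) x) (x : M) : TangentSpace 𝓘(ℝ, E) x :=
  P.toEnd x (P.toEnd x (mlieBracket 𝓘(ℝ, E) X Y x))
    + mlieBracket 𝓘(ℝ, E) (P.app X) (P.app Y) x
    - P.toEnd x (mlieBracket 𝓘(ℝ, E) (P.app X) Y x)
    - P.toEnd x (mlieBracket 𝓘(ℝ, E) X (P.app Y) x)

/-- `P` is integrable: its Nijenhuis tensor vanishes (on all local smooth vector fields). -/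
def IsIntegrable : Prop :=
  ∀ (x : M) (X Y : Π x : M, TangentSpace 𝓘(ℝ, E) x),
    CMDiffAt ∞ (T% X) x → CMDiffAt ∞ (T% Y) x → P.nijenhuis X Y x = 0

/-- The Lie derivative `(L_Y P)X = [Y, PX] - P[Y, X]`. -/
def lieDeriv (Y X : Π x : M, TangentSpace 𝓘(ℝ, E) x) (x : M) : TangentSpace 𝓘(ℝ, E) x :=
  mlieBracket 𝓘(ℝ, E) Y (P.app X) x - P.toEnd x (mlieBracket 𝓘(ℝ, E) Y X x)

/-- The Tachibana operator `φ_P` applied to the metric: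
`(φ_P h)(X, Y, Z) = (PX)(h(Y, Z)) - X(h(PY, Z)) + h((L_Y P)X, Z) + h(Y, (L_Z P)X)`. -/
def tachibana (X Y Z : Π x : M, TangentSpace 𝓘(ℝ, E) x) (x : M) : ℝ :=
  mvfderiv 𝓘(ℝ, E) (fun y ↦ h.inner y (Y y) (Z y)) x (P.app X x)
    - mvfderiv 𝓘(ℝ, E) (fun y ↦ h.inner y (P.app Y y) (Z y)) x (X x)
    + h.inner x (P.lieDeriv Y X x) (Z x) + h.inner x (Y x) (P.lieDeriv Z X x)

/-- `(Ψ_P h)(X, Y, Z) = (φ_P h)(X, Y, Z) + (φ_P h)(Z, Y, X)`. -/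
def psi (X Y Z : Π x : M, TangentSpace 𝓘(ℝ, E) x) (x : M) : ℝ :=
  P.tachibana h X Y Z x + P.tachibana h Z Y X x

/-- The condition `(Ψ_P h)(X, Y, Z) = (Ψ_P h)(Y, X, Z) + (Ψ_P h)(PY, PX, Z)` (on all local smooth
vector fields). -/
def PsiCondition : Prop :=
  ∀ (x : M) (X Y Z : Π x : M, TangentSpace 𝓘(ℝ, E) x),
    CMDiffAt ∞ (T% X) x → CMDiffAt ∞ (T% Y) x → CMDiffAt ∞ (T% Z) x →
      P.psi h X Y Z x = P.psi h Y X Z x + P.psi h (P.app Y) (P.app X) Z x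

/-- The expression `Y ↦ ∇(PY) - P ∇Y` is tensorial in `Y`. -/
theorem tensorial_nabla (x : M) :
    TensorialAt 𝓘(ℝ, E) E (fun Y : Π x : M, TangentSpace 𝓘(ℝ, E) x ↦
      h.leviCivita (P.app Y) x - P.toEnd x ∘L h.leviCivita Y x) x where
  smul {f Y} hf hY := by
    have e : P.app (f • Y) = f • P.app Y := by funext y; simp [app]
    ext u
    simp [e, h.leviCivita.isCovariantDerivativeOn.leibniz hY hf,
      h.leviCivita.isCovariantDerivativeOn.leibniz (P.mdifferentiableAt_app hY) hf]
    simp [app]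
    module
  add {Y Y'} hY hY' := by
    have e : P.app (Y + Y') = P.app Y + P.app Y' := by funext y; simp [app]
    ext u
    simp [e, h.leviCivita.isCovariantDerivativeOn.add hY hY',
      h.leviCivita.isCovariantDerivativeOn.add (P.mdifferentiableAt_app hY)
        (P.mdifferentiableAt_app hY')]
    abel

/-- The covariant derivative `(∇_u P)v` with respect to the Levi-Civita connection. -/
def nabla (x : M) (u v : TangentSpace 𝓘(ℝ, E) x) : TangentSpace 𝓘(ℝ, E) x :=
  TensorialAt.mkHom _ x (P.tensorial_nabla h x) v u

/-- `(∇_X P)Y = ∇_X(PY) - P(∇_X Y)` for vector fields. -/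
theorem nabla_apply {x : M} (X : Π x : M, TangentSpace 𝓘(ℝ, E) x)
    {Y : Π x : M, TangentSpace 𝓘(ℝ, E) x} (hY : MDiffAt (T% Y) x) :
    P.nabla h x (X x) (Y x)
      = h.leviCivita (P.app Y) x (X x) - P.toEnd x (h.leviCivita Y x (X x)) := by
  rw [nabla, TensorialAt.mkHom_apply (P.tensorial_nabla h x) hY]
  rfl

/-- `S_P(u, v) = (∇_u P)v + P((∇_{Pu} P)v)`. -/
def sTensor (x : M) (u v : TangentSpace 𝓘(ℝ, E) x) : TangentSpace 𝓘(ℝ, E) x :=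
  P.nabla h x u v + P.toEnd x (P.nabla h x (P.toEnd x u) v)

/-- The divergence `div P = ∑ h^{ij} (∇_{e_i} P)e_j`. -/
def div (x : M) : TangentSpace 𝓘(ℝ, E) x := h.trace x (P.nabla h x)

/-- `(M, h, P)` is almost para-Hermitian: `h` is hyperbolic with respect to `P`. -/
def IsAlmostParaHermitian : Prop :=
  ∀ (x : M) (u v : TangentSpace 𝓘(ℝ, E) x), h.inner x (P.toEnd x u) v = -h.inner x u (P.toEnd x v)

/-- `(M, h, P)` is almost product Riemannian: `h` is Riemannian and pure with respect to `P`. -/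
def IsAlmostProductRiemannian : Prop :=
  h.IsRiemannian ∧
    ∀ (x : M) (u v : TangentSpace 𝓘(ℝ, E) x), h.inner x (P.toEnd x u) v = h.inner x u (P.toEnd x v)

/-- `(M, h, P)` is quasi para-Kähler: almost para-Hermitian with `S_P = 0`. -/
def IsQuasiParaKaehler : Prop :=
  P.IsAlmostParaHermitian h ∧ ∀ (x : M) (u v : TangentSpace 𝓘(ℝ, E) x), P.sTensor h x u v = 0

/-- `(M, h, P)` is semi para-Kähler: almost para-Hermitian with `div P = 0`. -/
def IsSemiParaKaehler : Prop :=
  P.IsAlmostParaHermitian h ∧ ∀ x : M, P.div h x = 0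

/-- `(M, h, P)` is locally decomposable product Riemannian: it is almost product Riemannian, `P` is
integrable, and the condition on `Ψ_P h` holds. -/
def IsLocallyDecomposable : Prop :=
  P.IsAlmostProductRiemannian h ∧ P.IsIntegrable ∧ P.PsiCondition h

end AlmostProductStructure

variable {E' : Type*} [NormedAddCommGroup E'] [NormedSpace ℝ E'] [FiniteDimensional ℝ E']
  {N : Type*} [TopologicalSpace N] [ChartedSpace E' N] [IsManifold 𝓘(ℝ, E') ∞ N]

/-- `F` is `(P, Q)`-paraholomorphic: `F_* ∘ P = Q ∘ F_*`. -/
def IsParaholomorphic (P : AlmostProductStructure E M) (Q : AlmostProductStructure E' N)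
    (F : M → N) : Prop :=
  ∀ (x : M) (u : TangentSpace 𝓘(ℝ, E) x), mfderiv 𝓘(ℝ, E) 𝓘(ℝ, E') F x (P.toEnd x u)
    = Q.toEnd (F x) (mfderiv 𝓘(ℝ, E) 𝓘(ℝ, E') F x u)

/-- `F` is `(P, Q)`-anti-paraholomorphic: `F_* ∘ P = -Q ∘ F_*`. -/
def IsAntiParaholomorphic (P : AlmostProductStructure E M) (Q : AlmostProductStructure E' N)
    (F : M → N) : Prop :=
  ∀ (x : M) (u : TangentSpace 𝓘(ℝ, E) x), mfderiv 𝓘(ℝ, E) 𝓘(ℝ, E') F x (P.toEnd x u)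
    = -Q.toEnd (F x) (mfderiv 𝓘(ℝ, E) 𝓘(ℝ, E') F x u)

/-- The covariant derivative along a map `F : M → N` (the connection induced on `F^* TN`) of a
vector field `W` along `F`, in the direction `u`. Writing `W = ∑ W^k ∂_k` in the frame `(∂_k)` of
`TN` around `F x` given by the trivialization of `TN` at `F x`, it is
`∑ dW^k(u) ∂_k + ∑ W^k ∇_{F_* u} ∂_k`; note that `FiberBundle.extend E' (W x)` is the field
`∑ W^k(x) ∂_k`. -/
def covDerivAlong (g : SemiRiemannianMetric E' N) (F : M → N)
    (W : Π x : M, TangentSpace 𝓘(ℝ, E') (F x)) (x : M) (u : TangentSpace 𝓘(ℝ, E) x) :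
    TangentSpace 𝓘(ℝ, E') (F x) :=
  let t := trivializationAt E' (TangentSpace 𝓘(ℝ, E') : N → Type _) (F x)
  t.symmL ℝ (F x) (mvfderiv 𝓘(ℝ, E) (fun y ↦ (t ⟨F y, W y⟩).2) x u)
    + g.leviCivita (FiberBundle.extend E' (W x)) (F x) (mfderiv 𝓘(ℝ, E) 𝓘(ℝ, E') F x u)

/-- The second fundamental form `(∇F_*)(X, Y) = ∇^N_{F_* X}(F_* Y) - F_*(∇^M_X Y)`. -/
def secondFundamentalForm (h : SemiRiemannianMetric E M) (g : SemiRiemannianMetric E' N)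
    (F : M → N) (X Y : Π x : M, TangentSpace 𝓘(ℝ, E) x) (x : M) :
    TangentSpace 𝓘(ℝ, E') (F x) :=
  covDerivAlong g F (fun y ↦ mfderiv 𝓘(ℝ, E) 𝓘(ℝ, E') F y (Y y)) x (X x)
    - mfderiv 𝓘(ℝ, E) 𝓘(ℝ, E') F x (h.leviCivita Y x (X x))

/-- The tension field `∑ h^{ij} (∇F_*)(e_i, e_j)`. (The second fundamental form is tensorial, so it
is evaluated on tangent vectors by means of arbitrary smooth local extensions.) -/
def tensionField (h : SemiRiemannianMetric E M) (g : SemiRiemannianMetric E' N)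
    (F : M → N) (x : M) : TangentSpace 𝓘(ℝ, E') (F x) :=
  h.trace x fun u v ↦
    secondFundamentalForm h g F (FiberBundle.extend E u) (FiberBundle.extend E v) x

/-- A harmonic map: a smooth map whose tension field vanishes. -/
def IsHarmonic (h : SemiRiemannianMetric E M) (g : SemiRiemannianMetric E' N)
    (F : M → N) : Prop :=
  ContMDiff 𝓘(ℝ, E) 𝓘(ℝ, E') ∞ F ∧ ∀ x : M, tensionField h g F x = 0

end ParaGeometry

open Topology

/-! Write `B = ∇F_*`, and let `ε = ±1` be the sign in `F_* P = ε Q F_*`. Differentiating this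
relation gives `B(u, Pv) = ε (∇_{F_* u} Q) F_* v + ε Q B(u, v) - F_*((∇_u P) v)`, and the proof
takes the metric trace of both sides.

The left side has trace zero: `B` is symmetric and `P` is skew for `h`, so moving `P` from one slot
to the other changes the sign of the trace but not its value. The last term contributes `F_*(div P)
= 0`. The first term, `C(u, v) = (∇_{F_* u} Q) F_* v` up to sign, also has trace zero. In the quasi
para-Kähler case, `S_Q = 0` together with `(∇Q)Q = -Q(∇Q)` gives `C(Pu, Pv) = C(u, v)`, whereas
skewness and `P² = I` show that `C(P·, P·)` has trace `-tr C`. In the locally decomposable case `∇Q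
= 0`. What remains is `ε Q(τ(F)) = 0`, and `Q` is invertible.

The algebra rests on `trace_skew`, `nabla_toEnd` and `nabla_eq_zero`. The analytic input is the
Leibniz rule `covDerivAlong_toEnd`, and the symmetry and tensoriality of the second fundamental
form; these are obtained in trivializations, from symmetric Christoffel symbols and the symmetry of
second derivatives. -/

noncomputable section Harmonic

variable {E : Type*} [NormedAddCommGroup E] [NormedSpace ℝ E] [FiniteDimensional ℝ E]
  {M : Type*} [TopologicalSpace M] [ChartedSpace E M] [IsManifold 𝓘(ℝ, E) ∞ M]
  {E' : Type*} [NormedAddCommGroup E'] [NormedSpace ℝ E'] [FiniteDimensional ℝ E']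
  {N : Type*} [TopologicalSpace N] [ChartedSpace E' N] [IsManifold 𝓘(ℝ, E') ∞ N]

/-! ### Linear algebra of the metric trace. -/

namespace SemiRiemannianMetric
variable (h : SemiRiemannianMetric E M)

/-- The basis of the tangent space used in `trace`. -/
def traceBasis (x : M) : Module.Basis (Fin (Module.finrank ℝ E)) ℝ (TangentSpace 𝓘(ℝ, E) x) :=
  Module.finBasis ℝ E

/-- The Gram matrix of the metric. -/
def gram (x : M) : Matrix (Fin (Module.finrank ℝ E)) (Fin (Module.finrank ℝ E)) ℝ :=
  Matrix.of fun i j ↦ h.inner x (traceBasis x i) (traceBasis x j)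

section trace

variable {W : Type*} [AddCommGroup W] [Module ℝ W] {x : M}

theorem trace_eq (B : TangentSpace 𝓘(ℝ, E) x → TangentSpace 𝓘(ℝ, E) x → W) :
    h.trace x B = ∑ i, ∑ j, (h.gram x)⁻¹ i j • B (traceBasis x i) (traceBasis x j) := rfl

theorem gram_transpose : (h.gram x).transpose = h.gram x := by
  ext i j
  exact h.symm x _ _

/-- A kernel vector of the Gram matrix is the coordinate vector of a tangent vector orthogonal to
everything. Invertibility makes the matrix inverse in `trace` a genuine one rather than the default
value `0`. -/
theorem isUnit_gram : IsUnit (h.gram x) := by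
  rw [← Matrix.mulVec_injective_iff_isUnit, ← Matrix.coe_mulVecLin, injective_iff_map_eq_zero]
  intro a ha
  have key : ∑ j, a j • traceBasis x j = 0 := by
    refine h.nondegenerate x _ fun v ↦ ?_
    have hs (i) : h.inner x (traceBasis x i) (∑ j, a j • traceBasis x j) = 0 := by
      have := congrFun ha i
      simp only [Matrix.mulVecLin_apply, Matrix.mulVec, dotProduct, gram, Matrix.of_apply,
        Pi.zero_apply] at this
      simp [← this, mul_comm]
    rw [h.symm, ← (traceBasis x).sum_repr v]
    rw [map_sum (h.inner x), sum_apply]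
    exact Finset.sum_eq_zero fun i _ ↦ by rw [map_smul, smul_apply, hs, smul_zero]
  ext j
  exact Fintype.linearIndependent_iff.1 (traceBasis x).linearIndependent a key j

theorem map_trace {W' : Type*} [AddCommGroup W'] [Module ℝ W'] (L : W →ₗ[ℝ] W')
    (B : TangentSpace 𝓘(ℝ, E) x → TangentSpace 𝓘(ℝ, E) x → W) :
    L (h.trace x B) = h.trace x fun u v ↦ L (B u v) := by
  simp [trace_eq, map_sum]

/-- The inverse of the symmetric Gram matrix is symmetric; no linearity of `B` is needed. -/
theorem trace_swap (B : TangentSpace 𝓘(ℝ, E) x → TangentSpace 𝓘(ℝ, E) x → W) :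
    h.trace x (fun u v ↦ B v u) = h.trace x B := by
  rw [trace_eq, trace_eq, Finset.sum_comm]
  refine Finset.sum_congr rfl fun i _ ↦ Finset.sum_congr rfl fun j _ ↦ ?_
  rw [← Matrix.transpose_apply ((h.gram x)⁻¹), Matrix.transpose_nonsing_inv, gram_transpose]

/-- A skew-adjoint endomorphism can be moved from one argument of a bilinear map to the other under
the trace, up to sign. -/
theorem trace_skew (B : TangentSpace 𝓘(ℝ, E) x →ₗ[ℝ] TangentSpace 𝓘(ℝ, E) x →ₗ[ℝ] W)
    (A : TangentSpace 𝓘(ℝ, E) x →ₗ[ℝ] TangentSpace 𝓘(ℝ, E) x)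
    (hA : ∀ u v, h.inner x (A u) v = -h.inner x u (A v)) :
    h.trace x (fun u v ↦ B u (A v)) = -h.trace x fun u v ↦ B (A u) v := by
  set G := h.gram x with hG
  set b : Module.Basis _ ℝ (TangentSpace 𝓘(ℝ, E) x) := traceBasis x with hb
  set a := LinearMap.toMatrix b b A with ha
  have hAb (j) : A (b j) = ∑ k, a k j • b k := by
    rw [← b.sum_repr (A (b j))]
    simp [ha, LinearMap.toMatrix_apply]
  have h1 : a.transpose * G = -(G * a) := by
    ext i j
    have := hA (b i) (b j)
    simp only [hAb, map_sum, map_smul, sum_apply, smul_apply] at this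
    simpa [Matrix.mul_apply, hG, gram, mul_comm] using this
  have hu : IsUnit G.det := (Matrix.isUnit_iff_isUnit_det _).1 h.isUnit_gram
  -- Skewness is transferred from `G` to `G⁻¹`. Expanding `A` in the basis, `A` in the second slot
  -- contracts `B` with `G⁻¹ aᵀ`, and `A` in the first slot contracts it with `a G⁻¹`.
  have h2 : G⁻¹ * a.transpose = -(a * G⁻¹) := by
    calc G⁻¹ * a.transpose = G⁻¹ * (a.transpose * G) * G⁻¹ := by
          rw [Matrix.mul_assoc, Matrix.mul_assoc, Matrix.mul_nonsing_inv _ hu, Matrix.mul_one]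
      _ = -(a * G⁻¹) := by
          rw [h1, Matrix.mul_neg, ← Matrix.mul_assoc, Matrix.nonsing_inv_mul _ hu, Matrix.one_mul,
            Matrix.neg_mul]
  have e1 : h.trace x (fun u v ↦ B u (A v)) = ∑ i, ∑ k, (G⁻¹ * a.transpose) i k • B (b i) (b k) := by
    rw [trace_eq]
    refine Finset.sum_congr rfl fun i _ ↦ ?_
    simp only [← hb, hAb, map_sum, map_smul, Matrix.mul_apply, Matrix.transpose_apply,
      Finset.sum_smul, Finset.smul_sum, smul_smul, ← hG]
    exact Finset.sum_comm
  have e2 : h.trace x (fun u v ↦ B (A u) v) = ∑ i, ∑ k, (a * G⁻¹) i k • B (b i) (b k) := by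
    rw [trace_eq, Finset.sum_comm, Finset.sum_comm (γ := Fin (Module.finrank ℝ E))
      (f := fun i k ↦ (a * G⁻¹) i k • B (b i) (b k))]
    refine Finset.sum_congr rfl fun i _ ↦ ?_
    simp only [← hb, hAb, map_sum, map_smul, Matrix.mul_apply,
      Finset.sum_smul, Finset.smul_sum, smul_smul, ← hG, LinearMap.sum_apply, LinearMap.smul_apply]
    rw [Finset.sum_comm]
    simp only [mul_comm]
  rw [e1, e2, h2]
  simp

end trace
end SemiRiemannianMetric

/-! ### Local coordinates: the connection as derivative plus Christoffel symbol. -/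

section coordinates

variable (E) in
/-- The fibre coordinate of tangent vectors at `y` in the trivialization at `x`. -/
abbrev fibreCoord (x : M) (y : M) (u : TangentSpace 𝓘(ℝ, E) y) : E :=
  (trivializationAt E (TangentSpace 𝓘(ℝ, E) : M → Type _) x ⟨y, u⟩).2

theorem eventually_mem_baseSet (x : M) :
    ∀ᶠ y in 𝓝 x, y ∈ (trivializationAt E (TangentSpace 𝓘(ℝ, E) : M → Type _) x).baseSet :=
  (trivializationAt E (TangentSpace 𝓘(ℝ, E) : M → Type _) x).open_baseSet.mem_nhds
    (FiberBundle.mem_baseSet_trivializationAt' x)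

theorem fibreCoord_eq_continuousLinearMapAt {x y : M}
    (hy : y ∈ (trivializationAt E (TangentSpace 𝓘(ℝ, E) : M → Type _) x).baseSet)
    (u : TangentSpace 𝓘(ℝ, E) y) :
    fibreCoord E x y u
      = (trivializationAt E (TangentSpace 𝓘(ℝ, E) : M → Type _) x).continuousLinearMapAt ℝ y u :=
  (Trivialization.continuousLinearMapAt_apply_of_mem (R := ℝ) _ hy u).symm

theorem fibreCoord_add {x y : M}
    (hy : y ∈ (trivializationAt E (TangentSpace 𝓘(ℝ, E) : M → Type _) x).baseSet)
    (u v : TangentSpace 𝓘(ℝ, E) y) :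
    fibreCoord E x y (u + v) = fibreCoord E x y u + fibreCoord E x y v := by
  simp only [fibreCoord_eq_continuousLinearMapAt hy, map_add]

theorem fibreCoord_smul {x y : M}
    (hy : y ∈ (trivializationAt E (TangentSpace 𝓘(ℝ, E) : M → Type _) x).baseSet)
    (c : ℝ) (u : TangentSpace 𝓘(ℝ, E) y) :
    fibreCoord E x y (c • u) = c • fibreCoord E x y u := by
  simp only [fibreCoord_eq_continuousLinearMapAt hy, map_smul]

theorem fibreCoord_extend {x y : M}
    (hy : y ∈ (trivializationAt E (TangentSpace 𝓘(ℝ, E) : M → Type _) x).baseSet)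
    (u : TangentSpace 𝓘(ℝ, E) x) :
    fibreCoord E x y (FiberBundle.extend E u y) = fibreCoord E x x u := by
  simp [fibreCoord, FiberBundle.extend, Trivialization.apply_mk_symm _ hy]

theorem symmL_fibreCoord (x : M) (u : TangentSpace 𝓘(ℝ, E) x) :
    (trivializationAt E (TangentSpace 𝓘(ℝ, E) : M → Type _) x).symmL ℝ x (fibreCoord E x x u) = u := by
  have hx := FiberBundle.mem_baseSet_trivializationAt' (F := E)
    (E := (TangentSpace 𝓘(ℝ, E) : M → Type _)) x
  rw [fibreCoord_eq_continuousLinearMapAt hx, Trivialization.symmL_continuousLinearMapAt _ hx]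

theorem mvfderiv_congr_of_eventuallyEq {V : Type*} [NormedAddCommGroup V] [NormedSpace ℝ V]
    {f f' : M → V} {x : M} (hf : f =ᶠ[𝓝 x] f') :
    mvfderiv 𝓘(ℝ, E) f x = mvfderiv 𝓘(ℝ, E) f' x := by
  have hx := hf.self_of_nhds
  have := hf.mfderiv_eq (I := 𝓘(ℝ, E)) (I' := 𝓘(ℝ, V))
  ext u
  exact congr($this u)

theorem mvfderiv_clm_apply {V W : Type*} [NormedAddCommGroup V] [NormedSpace ℝ V]
    [NormedAddCommGroup W] [NormedSpace ℝ W] {A : M → V →L[ℝ] W} {w : M → V} {x : M}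
    (hA : MDifferentiableAt 𝓘(ℝ, E) 𝓘(ℝ, V →L[ℝ] W) A x)
    (hw : MDifferentiableAt 𝓘(ℝ, E) 𝓘(ℝ, V) w x) (u : TangentSpace 𝓘(ℝ, E) x) :
    mvfderiv 𝓘(ℝ, E) (fun y ↦ A y (w y)) x u
      = mvfderiv 𝓘(ℝ, E) A x u (w x) + A x (mvfderiv 𝓘(ℝ, E) w x u) := by
  let φ := extChartAt 𝓘(ℝ, E) x
  have hφ : φ.symm (φ x) = x := extChartAt_to_inv x
  have hA' : HasFDerivWithinAt (fun z ↦ A (φ.symm z)) (mvfderiv 𝓘(ℝ, E) A x : E →L[ℝ] V →L[ℝ] W)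
    (Set.range 𝓘(ℝ, E)) (φ x) := hA.hasMFDerivAt.2
  have hw' : HasFDerivWithinAt (fun z ↦ w (φ.symm z)) (mvfderiv 𝓘(ℝ, E) w x : E →L[ℝ] V)
    (Set.range 𝓘(ℝ, E)) (φ x) := hw.hasMFDerivAt.2
  have hAw := hA'.clm_apply hw'
  -- The product rule in the chart evaluates `A` and `w` at `φ.symm (φ x)`, which must be identified
  -- with `x`.
  rw [hφ] at hAw
  have key : HasMFDerivAt 𝓘(ℝ, E) 𝓘(ℝ, W) (fun y ↦ A y (w y)) x _ :=
    ⟨(hA.clm_apply hw).continuousAt, hAw⟩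
  refine (congr($key.mfderiv u)).trans ?_
  exact add_comm (A x (mvfderiv 𝓘(ℝ, E) w x u)) (mvfderiv 𝓘(ℝ, E) A x u (w x))

theorem mdifferentiableAt_fibreCoord {Y : Π x : M, TangentSpace 𝓘(ℝ, E) x} {x : M}
    (hY : MDiffAt (T% Y) x) :
    MDifferentiableAt 𝓘(ℝ, E) 𝓘(ℝ, E) (fun y ↦ fibreCoord E x y (Y y)) x :=
  (mdifferentiableAt_section (F := E) 𝓘(ℝ, E) Y).1 hY

namespace SemiRiemannianMetric

variable (h : SemiRiemannianMetric E M)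

/-- The Levi-Civita connection and the flat connection of the trivialization obey the same Leibniz
rule, so the derivatives of the coefficient function cancel in their difference. -/
theorem tensorial_leviCivita_sub (x : M) :
    TensorialAt 𝓘(ℝ, E) E (fun Y : Π x : M, TangentSpace 𝓘(ℝ, E) x ↦ h.leviCivita Y x
      - (trivializationAt E (TangentSpace 𝓘(ℝ, E) : M → Type _) x).symmL ℝ x ∘L
          mvfderiv 𝓘(ℝ, E) (fun y ↦ fibreCoord E x y (Y y)) x) x where
  smul {f Y} hf hY := by
    have e : (fun y ↦ fibreCoord E x y ((f • Y) y)) =ᶠ[𝓝 x] f • fun y ↦ fibreCoord E x y (Y y) := by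
      filter_upwards [eventually_mem_baseSet (E := E) x] with y hy
      exact fibreCoord_smul hy _ _
    rw [mvfderiv_congr_of_eventuallyEq e, mvfderiv_smul hf (mdifferentiableAt_fibreCoord hY),
      h.leviCivita.isCovariantDerivativeOn.leibniz hY hf]
    have := symmL_fibreCoord x (Y x)
    ext u
    simp [this]
    module
  add {Y Y'} hY hY' := by
    have e : (fun y ↦ fibreCoord E x y ((Y + Y') y))
        =ᶠ[𝓝 x] (fun y ↦ fibreCoord E x y (Y y)) + fun y ↦ fibreCoord E x y (Y' y) := by
      filter_upwards [eventually_mem_baseSet (E := E) x] with y hy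
      exact fibreCoord_add hy _ _
    rw [mvfderiv_congr_of_eventuallyEq e, mvfderiv_add (mdifferentiableAt_fibreCoord hY)
      (mdifferentiableAt_fibreCoord hY'), h.leviCivita.isCovariantDerivativeOn.add hY hY']
    ext u
    simp
    module

/-- The Christoffel symbol at `x`, in the frame of the tangent bundle around `x`: the covariant
derivative in the direction of the second argument of the extension of the first argument. -/
def christoffel (x : M) :
    TangentSpace 𝓘(ℝ, E) x →L[ℝ] TangentSpace 𝓘(ℝ, E) x →L[ℝ] TangentSpace 𝓘(ℝ, E) x :=
  TensorialAt.mkHom _ x (h.tensorial_leviCivita_sub x)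

theorem leviCivita_eq_coord {Y : Π x : M, TangentSpace 𝓘(ℝ, E) x} {x : M}
    (hY : MDiffAt (T% Y) x) (u : TangentSpace 𝓘(ℝ, E) x) :
    h.leviCivita Y x u
      = (trivializationAt E (TangentSpace 𝓘(ℝ, E) : M → Type _) x).symmL ℝ x
          (mvfderiv 𝓘(ℝ, E) (fun y ↦ fibreCoord E x y (Y y)) x u)
        + h.christoffel x (Y x) u := by
  rw [christoffel, TensorialAt.mkHom_apply _ hY]
  simp

/-- The extended field has constant fibre coordinate near `x`, so only the Christoffel term
survives. -/
theorem leviCivita_extend {x : M} (u v : TangentSpace 𝓘(ℝ, E) x) :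
    h.leviCivita (FiberBundle.extend E v) x u = h.christoffel x v u := by
  have e : (fun y ↦ fibreCoord E x y (FiberBundle.extend E v y)) =ᶠ[𝓝 x] fun _ ↦ fibreCoord E x x v := by
    filter_upwards [eventually_mem_baseSet (E := E) x] with y hy
    exact fibreCoord_extend hy _
  rw [h.leviCivita_eq_coord (FiberBundle.mdifferentiableAt_extend 𝓘(ℝ, E) E v),
    mvfderiv_congr_of_eventuallyEq e, mvfderiv_const]
  simp

end SemiRiemannianMetric

end coordinates

/-! ### The tensor `∇P` in coordinates. -/

namespace AlmostProductStructure

variable (P : AlmostProductStructure E M) (h : SemiRiemannianMetric E M)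

/-- The endomorphism of the model space representing `P` at `y` in the trivialization at `x`. -/
abbrev coordEnd (x y : M) : E →L[ℝ] E :=
  (trivializationAt E (TangentSpace 𝓘(ℝ, E) : M → Type _) x).continuousLinearMapAt ℝ y ∘L
    P.toEnd y ∘L (trivializationAt E (TangentSpace 𝓘(ℝ, E) : M → Type _) x).symmL ℝ y

theorem mdifferentiableAt_coordEnd (x : M) :
    MDifferentiableAt 𝓘(ℝ, E) 𝓘(ℝ, E →L[ℝ] E) (P.coordEnd x) x :=
  ((mdifferentiableAt_hom_bundle _).1 (P.contMDiff.mdifferentiableAt (by simp))).2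

theorem fibreCoord_toEnd {x y : M}
    (hy : y ∈ (trivializationAt E (TangentSpace 𝓘(ℝ, E) : M → Type _) x).baseSet)
    (u : TangentSpace 𝓘(ℝ, E) y) :
    fibreCoord E x y (P.toEnd y u) = P.coordEnd x y (fibreCoord E x y u) := by
  rw [fibreCoord_eq_continuousLinearMapAt hy, fibreCoord_eq_continuousLinearMapAt hy]
  simp only [coordEnd, ContinuousLinearMap.comp_apply,
    Trivialization.symmL_continuousLinearMapAt _ hy]

/-- This is `∇P = dP + [Γ, P]`. It allows `∇Q` to be compared with derivatives of fields along `F`,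
which need not be restrictions of vector fields on `N`. -/
theorem nabla_eq_coord (x : M) (u v : TangentSpace 𝓘(ℝ, E) x) :
    P.nabla h x u v
      = (trivializationAt E (TangentSpace 𝓘(ℝ, E) : M → Type _) x).symmL ℝ x
          (mvfderiv 𝓘(ℝ, E) (P.coordEnd x) x u (fibreCoord E x x v))
        + h.christoffel x (P.toEnd x v) u - P.toEnd x (h.christoffel x v u) := by
  have hv := FiberBundle.mdifferentiableAt_extend 𝓘(ℝ, E) E v
  have hu := FiberBundle.mdifferentiableAt_extend 𝓘(ℝ, E) E u
  have e1 := P.nabla_apply h (FiberBundle.extend E u) hv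
  rw [h.leviCivita_eq_coord (P.mdifferentiableAt_app hv)] at e1
  simp only [FiberBundle.extend_apply_self, h.leviCivita_extend, app] at e1
  have e : (fun y ↦ fibreCoord E x y (P.toEnd y (FiberBundle.extend E v y)))
      =ᶠ[𝓝 x] fun y ↦ P.coordEnd x y (fibreCoord E x x v) := by
    filter_upwards [eventually_mem_baseSet (E := E) x] with y hy
    rw [P.fibreCoord_toEnd hy, fibreCoord_extend hy]
  rw [mvfderiv_congr_of_eventuallyEq e, mvfderiv_clm_apply (P.mdifferentiableAt_coordEnd x)
    mdifferentiableAt_const, mvfderiv_const] at e1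
  simpa using e1

end AlmostProductStructure

/-! ### The induced connection along a map. -/

section covDerivAlong

variable {F : M → N} {x : M} {W W' : Π x : M, TangentSpace 𝓘(ℝ, E') (F x)}
  (g : SemiRiemannianMetric E' N) (Q : AlmostProductStructure E' N)

theorem mdifferentiableAt_fibreCoord_along
    (hW : MDifferentiableAt 𝓘(ℝ, E) (𝓘(ℝ, E').prod 𝓘(ℝ, E'))
      (fun y ↦ TotalSpace.mk' E' (E := (TangentSpace 𝓘(ℝ, E') : N → Type _)) (F y) (W y)) x) :
    MDifferentiableAt 𝓘(ℝ, E) 𝓘(ℝ, E') (fun y ↦ fibreCoord E' (F x) (F y) (W y)) x :=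
  ((mdifferentiableAt_totalSpace _ _).1 hW).2

theorem covDerivAlong_eq_coord (u : TangentSpace 𝓘(ℝ, E) x) :
    covDerivAlong g F W x u
      = (trivializationAt E' (TangentSpace 𝓘(ℝ, E') : N → Type _) (F x)).symmL ℝ (F x)
          (mvfderiv 𝓘(ℝ, E) (fun y ↦ fibreCoord E' (F x) (F y) (W y)) x u)
        + g.christoffel (F x) (W x) (mfderiv 𝓘(ℝ, E) 𝓘(ℝ, E') F x u) := by
  rw [← g.leviCivita_extend]
  rfl

theorem eventually_mem_baseSet_along (hF : ContinuousAt F x) :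
    ∀ᶠ y in 𝓝 x, F y ∈ (trivializationAt E' (TangentSpace 𝓘(ℝ, E') : N → Type _) (F x)).baseSet :=
  hF.eventually (eventually_mem_baseSet (E := E') (F x))

theorem covDerivAlong_add (hF : ContinuousAt F x)
    (hW : MDifferentiableAt 𝓘(ℝ, E) (𝓘(ℝ, E').prod 𝓘(ℝ, E'))
      (fun y ↦ TotalSpace.mk' E' (E := (TangentSpace 𝓘(ℝ, E') : N → Type _)) (F y) (W y)) x)
    (hW' : MDifferentiableAt 𝓘(ℝ, E) (𝓘(ℝ, E').prod 𝓘(ℝ, E'))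
      (fun y ↦ TotalSpace.mk' E' (E := (TangentSpace 𝓘(ℝ, E') : N → Type _)) (F y) (W' y)) x)
    (u : TangentSpace 𝓘(ℝ, E) x) :
    covDerivAlong g F (fun y ↦ W y + W' y) x u
      = covDerivAlong g F W x u + covDerivAlong g F W' x u := by
  have e : (fun y ↦ fibreCoord E' (F x) (F y) (W y + W' y)) =ᶠ[𝓝 x]
      (fun y ↦ fibreCoord E' (F x) (F y) (W y)) + fun y ↦ fibreCoord E' (F x) (F y) (W' y) := by
    filter_upwards [eventually_mem_baseSet_along (E' := E') hF] with y hy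
    exact fibreCoord_add hy _ _
  rw [covDerivAlong_eq_coord, covDerivAlong_eq_coord, covDerivAlong_eq_coord,
    mvfderiv_congr_of_eventuallyEq e, mvfderiv_add (mdifferentiableAt_fibreCoord_along hW)
      (mdifferentiableAt_fibreCoord_along hW')]
  simp only [add_apply, map_add]
  abel

theorem covDerivAlong_smul {f : M → ℝ} (hF : ContinuousAt F x)
    (hf : MDifferentiableAt 𝓘(ℝ, E) 𝓘(ℝ, ℝ) f x)
    (hW : MDifferentiableAt 𝓘(ℝ, E) (𝓘(ℝ, E').prod 𝓘(ℝ, E'))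
      (fun y ↦ TotalSpace.mk' E' (E := (TangentSpace 𝓘(ℝ, E') : N → Type _)) (F y) (W y)) x)
    (u : TangentSpace 𝓘(ℝ, E) x) :
    covDerivAlong g F (fun y ↦ f y • W y) x u
      = f x • covDerivAlong g F W x u + mvfderiv 𝓘(ℝ, E) f x u • W x := by
  have e : (fun y ↦ fibreCoord E' (F x) (F y) (f y • W y)) =ᶠ[𝓝 x]
      f • fun y ↦ fibreCoord E' (F x) (F y) (W y) := by
    filter_upwards [eventually_mem_baseSet_along (E' := E') hF] with y hy
    exact fibreCoord_smul hy _ _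
  rw [covDerivAlong_eq_coord, covDerivAlong_eq_coord,
    mvfderiv_congr_of_eventuallyEq e, mvfderiv_smul hf (mdifferentiableAt_fibreCoord_along hW)]
  have := symmL_fibreCoord (F x) (W x)
  simp only [add_apply, smul_apply, map_add, map_smul, ContinuousLinearMap.smulRight_apply, this]
  module

/-- The Leibniz rule for the connection along `F` and an almost product structure. -/
theorem covDerivAlong_toEnd (hF : MDifferentiableAt 𝓘(ℝ, E) 𝓘(ℝ, E') F x)
    (hW : MDifferentiableAt 𝓘(ℝ, E) (𝓘(ℝ, E').prod 𝓘(ℝ, E'))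
      (fun y ↦ TotalSpace.mk' E' (E := (TangentSpace 𝓘(ℝ, E') : N → Type _)) (F y) (W y)) x)
    (u : TangentSpace 𝓘(ℝ, E) x) :
    covDerivAlong g F (fun y ↦ Q.toEnd (F y) (W y)) x u
      = Q.nabla g (F x) (mfderiv 𝓘(ℝ, E) 𝓘(ℝ, E') F x u) (W x)
        + Q.toEnd (F x) (covDerivAlong g F W x u) := by
  have hx := FiberBundle.mem_baseSet_trivializationAt' (F := E')
    (E := (TangentSpace 𝓘(ℝ, E') : N → Type _)) (F x)
  have e : (fun y ↦ fibreCoord E' (F x) (F y) (Q.toEnd (F y) (W y))) =ᶠ[𝓝 x]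
      fun y ↦ Q.coordEnd (F x) (F y) (fibreCoord E' (F x) (F y) (W y)) := by
    filter_upwards [eventually_mem_baseSet_along (E' := E') hF.continuousAt] with y hy
    exact Q.fibreCoord_toEnd hy _
  have hc := Q.mdifferentiableAt_coordEnd (F x)
  -- Chain rule: the derivative of `Q ∘ F` in the direction `u` is that of `Q` in the direction `F_*
  -- u`, which is what produces `∇_{F_* u} Q`.
  have e2 : mvfderiv 𝓘(ℝ, E) (fun y ↦ Q.coordEnd (F x) (F y)) x u
      = mvfderiv 𝓘(ℝ, E') (Q.coordEnd (F x)) (F x) (mfderiv 𝓘(ℝ, E) 𝓘(ℝ, E') F x u) :=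
    mfderiv_comp_apply x hc hF u
  rw [covDerivAlong_eq_coord, covDerivAlong_eq_coord, mvfderiv_congr_of_eventuallyEq e,
    mvfderiv_clm_apply (A := fun y ↦ Q.coordEnd (F x) (F y)) (hc.comp x hF)
      (mdifferentiableAt_fibreCoord_along hW), e2, Q.nabla_eq_coord g]
  simp only [map_add, AlmostProductStructure.coordEnd, ContinuousLinearMap.comp_apply,
    Trivialization.symmL_continuousLinearMapAt _ hx]
  abel

end covDerivAlong

/-! ### Coordinate fields commute, so Christoffel symbols are symmetric. -/

section bracket

/-- The tangent bundle is trivialized by the derivative of the chart, so extensions are the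
coordinate fields with constant coefficients. -/
theorem extend_extChartAt_symm {x : M} {z : E} (hz : z ∈ (extChartAt 𝓘(ℝ, E) x).target)
    (w : TangentSpace 𝓘(ℝ, E) x) :
    FiberBundle.extend E w ((extChartAt 𝓘(ℝ, E) x).symm z)
      = mfderivWithin 𝓘(ℝ, E) 𝓘(ℝ, E) (extChartAt 𝓘(ℝ, E) x).symm (Set.range 𝓘(ℝ, E)) z
          (fibreCoord E x x w) := by
  have hs : (extChartAt 𝓘(ℝ, E) x).symm z ∈ (chartAt E x).source := by
    simpa using (extChartAt 𝓘(ℝ, E) x).map_target hz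
  have h1 := TangentBundle.symmL_trivializationAt (I := 𝓘(ℝ, E)) hs
  rw [(extChartAt 𝓘(ℝ, E) x).right_inv hz] at h1
  exact (Trivialization.symmL_apply (R := ℝ) (trivializationAt E (TangentSpace 𝓘(ℝ, E)) x) hs
    (fibreCoord E x x w)).symm.trans congr($h1 _)

/-- Pulled back to the chart, both fields are constant near the base point. -/
theorem mlieBracket_extend {x : M} (u v : TangentSpace 𝓘(ℝ, E) x) :
    mlieBracket 𝓘(ℝ, E) (FiberBundle.extend E u) (FiberBundle.extend E v) x = 0 := by
  have key (w : TangentSpace 𝓘(ℝ, E) x) :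
      mpullbackWithin 𝓘(ℝ, E) 𝓘(ℝ, E) (extChartAt 𝓘(ℝ, E) x).symm (FiberBundle.extend E w)
        (Set.range 𝓘(ℝ, E)) =ᶠ[𝓝 (extChartAt 𝓘(ℝ, E) x x)] fun _ ↦ fibreCoord E x x w := by
    filter_upwards [extChartAt_target_mem_nhds (I := 𝓘(ℝ, E)) x] with z hz
    exact (isInvertible_mfderivWithin_extChartAt_symm (I := 𝓘(ℝ, E)) hz).inverse_apply_eq.2
      (extend_extChartAt_symm hz w)
  rw [← mlieBracketWithin_univ, mlieBracketWithin_apply]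
  refine (congrArg _ ((key u).lieBracketWithin_vectorField_eq_nhds (key v))).trans ?_
  refine (congrArg _ ?_).trans (map_zero _)
  simp only [lieBracketWithin, fderivWithin_const_apply, zero_apply, sub_zero]
  rfl

theorem SemiRiemannianMetric.christoffel_symm (h : SemiRiemannianMetric E M) {x : M}
    (u v : TangentSpace 𝓘(ℝ, E) x) : h.christoffel x u v = h.christoffel x v u := by
  have := (CovariantDerivative.torsion_eq_zero_iff _).1 h.leviCivita_torsion
    (FiberBundle.mdifferentiableAt_extend 𝓘(ℝ, E) E u)
    (FiberBundle.mdifferentiableAt_extend 𝓘(ℝ, E) E v)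
  rw [mlieBracket_extend] at this
  simp only [FiberBundle.extend_apply_self, h.leviCivita_extend] at this
  exact (sub_eq_zero.1 this).symm

end bracket

/-! ### Tensoriality and symmetry of the second fundamental form. -/

section secondFundamentalForm

variable {F : M → N} (h : SemiRiemannianMetric E M) (g : SemiRiemannianMetric E' N)

theorem mdifferentiableAt_mfderiv_apply (hF : ContMDiff 𝓘(ℝ, E) 𝓘(ℝ, E') ∞ F)
    {Y : Π x : M, TangentSpace 𝓘(ℝ, E) x} {x : M} (hY : MDiffAt (T% Y) x) :
    MDifferentiableAt 𝓘(ℝ, E) (𝓘(ℝ, E').prod 𝓘(ℝ, E'))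
      (fun y ↦ TotalSpace.mk' E' (E := (TangentSpace 𝓘(ℝ, E') : N → Type _)) (F y)
        (mfderiv 𝓘(ℝ, E) 𝓘(ℝ, E') F y (Y y))) x :=
  have h2 : ((1 + 1 : ℕ∞) : ℕ∞ω) ≤ ∞ := mod_cast le_top
  ((hF.contMDiff_tangentMap (m := 1) h2).mdifferentiable (by simp) _).comp x hY

/-- Both Leibniz rules, along `F` and on `M`, yield the same term `df(u) F_* Y`, which cancels. -/
theorem tensorial_secondFundamentalForm (hF : ContMDiff 𝓘(ℝ, E) 𝓘(ℝ, E') ∞ F) (x : M)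
    (u : TangentSpace 𝓘(ℝ, E) x) :
    TensorialAt 𝓘(ℝ, E) E
      (fun Y : Π x : M, TangentSpace 𝓘(ℝ, E) x ↦
        secondFundamentalForm h g F (FiberBundle.extend E u) Y x) x where
  smul {f Y} hf hY := by
    have e : (fun y ↦ mfderiv 𝓘(ℝ, E) 𝓘(ℝ, E') F y ((f • Y) y))
        = fun y ↦ f y • mfderiv 𝓘(ℝ, E) 𝓘(ℝ, E') F y (Y y) :=
      funext fun y ↦ map_smul (mfderiv 𝓘(ℝ, E) 𝓘(ℝ, E') F y) (f y) (Y y)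
    simp only [secondFundamentalForm, e,
      covDerivAlong_smul g hF.continuous.continuousAt hf (mdifferentiableAt_mfderiv_apply hF hY),
      h.leviCivita.isCovariantDerivativeOn.leibniz hY hf]
    simp
    module
  add {Y Y'} hY hY' := by
    have e : (fun y ↦ mfderiv 𝓘(ℝ, E) 𝓘(ℝ, E') F y ((Y + Y') y))
        = fun y ↦ mfderiv 𝓘(ℝ, E) 𝓘(ℝ, E') F y (Y y) + mfderiv 𝓘(ℝ, E) 𝓘(ℝ, E') F y (Y' y) :=
      funext fun y ↦ map_add (mfderiv 𝓘(ℝ, E) 𝓘(ℝ, E') F y) (Y y) (Y' y)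
    simp only [secondFundamentalForm, e,
      covDerivAlong_add g hF.continuous.continuousAt (mdifferentiableAt_mfderiv_apply hF hY)
        (mdifferentiableAt_mfderiv_apply hF hY'),
      h.leviCivita.isCovariantDerivativeOn.add hY hY']
    simp
    module

theorem fderiv_apply_symm {V : Type*} [NormedAddCommGroup V] [NormedSpace ℝ V] {f : E → V} {z : E}
    (hf : ContDiffAt ℝ 2 f z) (a b : E) :
    fderiv ℝ (fun y ↦ fderiv ℝ f y a) z b = fderiv ℝ (fun y ↦ fderiv ℝ f y b) z a := by
  have hs : IsSymmSndFDerivAt ℝ f z := hf.isSymmSndFDerivAt (by simp)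
  have hd : DifferentiableAt ℝ (fderiv ℝ f) z :=
    (hf.fderiv_right (m := 1) le_rfl).differentiableAt (by simp)
  rw [fderiv_clm_apply hd (by fun_prop), fderiv_clm_apply hd (by fun_prop)]
  simpa using hs.eq b a

/-- The Hessian of `F` in charts, as the derivative of the fibre coordinate of `F_* (extend v)`. -/
theorem mvfderiv_fibreCoord_mfderiv_extend (hF : ContMDiff 𝓘(ℝ, E) 𝓘(ℝ, E') ∞ F) {x : M}
    (u v : TangentSpace 𝓘(ℝ, E) x) :
    mvfderiv 𝓘(ℝ, E) (fun y ↦ fibreCoord E' (F x) (F y)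
        (mfderiv 𝓘(ℝ, E) 𝓘(ℝ, E') F y (FiberBundle.extend E v y))) x u
      = fderiv ℝ (fun z ↦ fderiv ℝ (writtenInExtChartAt 𝓘(ℝ, E) 𝓘(ℝ, E') x F) z
          (fibreCoord E x x v)) (extChartAt 𝓘(ℝ, E) x x) (fibreCoord E x x u) := by
  set c := fibreCoord E x x v
  let φ := extChartAt 𝓘(ℝ, E) x
  let ψ := extChartAt 𝓘(ℝ, E') (F x)
  -- The chart at `x` has identity derivative at its own base point, so `u` may be used directly as
  -- a direction in the model space.
  have hu : fibreCoord E x x u = u := by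
    rw [fibreCoord_eq_continuousLinearMapAt (FiberBundle.mem_baseSet_trivializationAt' x),
      TangentBundle.continuousLinearMapAt_trivializationAt (mem_chart_source E x),
      mfderiv_extChartAt_self]
    rfl
  have hmd := mdifferentiableAt_fibreCoord_along (mdifferentiableAt_mfderiv_apply hF
    (FiberBundle.mdifferentiableAt_extend 𝓘(ℝ, E) E v))
  have hφ : Filter.Tendsto φ.symm (𝓝 (φ x)) (𝓝 x) := by
    have := (continuousAt_extChartAt_symm (I := 𝓘(ℝ, E)) x).tendsto
    rwa [extChartAt_to_inv x] at this
  have key : (fun z ↦ fibreCoord E' (F x) (F (φ.symm z)) (mfderiv 𝓘(ℝ, E) 𝓘(ℝ, E') F (φ.symm z)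
      (FiberBundle.extend E v (φ.symm z)))) =ᶠ[𝓝 (φ x)]
      fun z ↦ fderiv ℝ (writtenInExtChartAt 𝓘(ℝ, E) 𝓘(ℝ, E') x F) z c := by
    filter_upwards [extChartAt_target_mem_nhds (I := 𝓘(ℝ, E)) x,
      hφ.eventually (eventually_mem_baseSet_along (E' := E') hF.continuous.continuousAt)] with z hz hz'
    have hs : MDifferentiableAt 𝓘(ℝ, E) 𝓘(ℝ, E) φ.symm z := by
      have := mdifferentiableWithinAt_extChartAt_symm hz
      rwa [modelWithCornersSelf_coe, Set.range_id, mdifferentiableWithinAt_univ] at this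
    have hψ : MDifferentiableAt 𝓘(ℝ, E') 𝓘(ℝ, E') ψ (F (φ.symm z)) :=
      mdifferentiableAt_extChartAt hz'
    have hFz : MDifferentiableAt 𝓘(ℝ, E) 𝓘(ℝ, E') F (φ.symm z) := hF.mdifferentiable (by simp) _
    have e1 := mfderiv_comp_apply z (hψ.comp _ hFz) hs c
    rw [mfderiv_comp_apply _ hψ hFz] at e1
    rw [fibreCoord_eq_continuousLinearMapAt hz', extend_extChartAt_symm hz,
      TangentBundle.continuousLinearMapAt_trivializationAt hz']
    rw [mfderiv_eq_fderiv] at e1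
    simp only [modelWithCornersSelf_coe, Set.range_id, mfderivWithin_univ]
    exact e1.symm
  rw [hmd.mvfderiv, hu]
  simp only [modelWithCornersSelf_coe, Set.range_id, fderivWithin_univ]
  exact congr($(key.fderiv_eq) u)

/-- In charts the form is the Hessian of `F` plus Christoffel terms of `N` and `M`, and each of the
three is symmetric. -/
theorem secondFundamentalForm_symm (hF : ContMDiff 𝓘(ℝ, E) 𝓘(ℝ, E') ∞ F) {x : M}
    (u v : TangentSpace 𝓘(ℝ, E) x) :
    secondFundamentalForm h g F (FiberBundle.extend E u) (FiberBundle.extend E v) x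
      = secondFundamentalForm h g F (FiberBundle.extend E v) (FiberBundle.extend E u) x := by
  have hc : ContDiffAt ℝ 2 (writtenInExtChartAt 𝓘(ℝ, E) 𝓘(ℝ, E') x F) (extChartAt 𝓘(ℝ, E) x x) := by
    have := (contMDiffAt_iff.1 (hF x)).2
    simp only [modelWithCornersSelf_coe, Set.range_id, contDiffWithinAt_univ] at this
    exact this.of_le (by norm_cast)
  simp only [secondFundamentalForm, covDerivAlong_eq_coord, FiberBundle.extend_apply_self,
    h.leviCivita_extend]
  rw [mvfderiv_fibreCoord_mfderiv_extend hF, mvfderiv_fibreCoord_mfderiv_extend hF,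
    fderiv_apply_symm hc, g.christoffel_symm, h.christoffel_symm]

end secondFundamentalForm

theorem SemiRiemannianMetric.leviCivita_sub_swap (h : SemiRiemannianMetric E M)
    {X Y : Π x : M, TangentSpace 𝓘(ℝ, E) x} {x : M}
    (hX : MDiffAt (T% X) x) (hY : MDiffAt (T% Y) x) :
    h.leviCivita Y x (X x) - h.leviCivita X x (Y x) = mlieBracket 𝓘(ℝ, E) X Y x :=
  (CovariantDerivative.torsion_eq_zero_iff _).1 h.leviCivita_torsion hX hY

/-! ### Identities for `∇P`; locally decomposable structures are parallel. -/

namespace AlmostProductStructure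

variable {P : AlmostProductStructure E M} {h : SemiRiemannianMetric E M}

/-- Differentiate `P² = I`. -/
theorem nabla_toEnd (x : M) (u v : TangentSpace 𝓘(ℝ, E) x) :
    P.nabla h x u (P.toEnd x v) = -P.toEnd x (P.nabla h x u v) := by
  have hv := FiberBundle.mdifferentiableAt_extend 𝓘(ℝ, E) E v
  have e1 := P.nabla_apply h (FiberBundle.extend E u) hv
  have e2 := P.nabla_apply h (FiberBundle.extend E u) (P.mdifferentiableAt_app hv)
  have e : P.app (P.app (FiberBundle.extend E v)) = FiberBundle.extend E v := by
    funext y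
    exact P.toEnd_toEnd y _
  rw [e] at e2
  simp only [FiberBundle.extend_apply_self, app] at e1 e2
  rw [e1, e2, map_sub, P.toEnd_toEnd]
  simp

/-- Differentiate `h(Pv, w) = h(v, Pw)`, using that the connection is metric. -/
theorem inner_nabla_comm (hP : P.IsAlmostProductRiemannian h) (x : M)
    (u v w : TangentSpace 𝓘(ℝ, E) x) :
    h.inner x (P.nabla h x u v) w = h.inner x v (P.nabla h x u w) := by
  have hu := FiberBundle.mdifferentiableAt_extend 𝓘(ℝ, E) E u
  have hv := FiberBundle.mdifferentiableAt_extend 𝓘(ℝ, E) E v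
  have hw := FiberBundle.mdifferentiableAt_extend 𝓘(ℝ, E) E w
  have e1 := P.nabla_apply h (FiberBundle.extend E u) hv
  have e2 := P.nabla_apply h (FiberBundle.extend E u) hw
  have e3 := h.leviCivita_metric hu (P.mdifferentiableAt_app hv) hw
  have e4 := h.leviCivita_metric hu hv (P.mdifferentiableAt_app hw)
  have e : (fun y ↦ h.inner y (P.app (FiberBundle.extend E v) y) (FiberBundle.extend E w y))
      = fun y ↦ h.inner y (FiberBundle.extend E v y) (P.app (FiberBundle.extend E w) y) :=
    funext fun y ↦ hP.2 y _ _
  rw [e, e4] at e3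
  simp only [FiberBundle.extend_apply_self, app] at e1 e2 e3
  rw [e1, e2]
  simp only [map_sub, sub_apply, hP.2] at e3 ⊢
  linarith

theorem lieDeriv_eq_leviCivita {X Y : Π x : M, TangentSpace 𝓘(ℝ, E) x} {x : M}
    (hX : MDiffAt (T% X) x) (hY : MDiffAt (T% Y) x) :
    P.lieDeriv Y X x = P.nabla h x (Y x) (X x) - h.leviCivita Y x (P.toEnd x (X x))
      + P.toEnd x (h.leviCivita Y x (X x)) := by
  rw [lieDeriv, ← h.leviCivita_sub_swap hY hX,
    ← h.leviCivita_sub_swap hY (P.mdifferentiableAt_app hX), P.nabla_apply h Y hX, map_sub]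
  simp only [app]
  abel

/-- Metric compatibility expands the derivatives of `h` and torsion-freeness the Lie derivatives;
every term without `∇P` then cancels because `P` is self-adjoint. -/
theorem tachibana_eq (hP : P.IsAlmostProductRiemannian h)
    {X Y Z : Π x : M, TangentSpace 𝓘(ℝ, E) x} {x : M}
    (hX : MDiffAt (T% X) x) (hY : MDiffAt (T% Y) x) (hZ : MDiffAt (T% Z) x) :
    P.tachibana h X Y Z x = -h.inner x (P.nabla h x (X x) (Y x)) (Z x)
      + h.inner x (P.nabla h x (Y x) (X x)) (Z x) + h.inner x (P.nabla h x (Z x) (X x)) (Y x) := by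
  rw [tachibana, h.leviCivita_metric (P.mdifferentiableAt_app hX) hY hZ,
    h.leviCivita_metric hX (P.mdifferentiableAt_app hY) hZ,
    lieDeriv_eq_leviCivita (h := h) hX hY, lieDeriv_eq_leviCivita (h := h) hX hZ,
    P.nabla_apply h X hY]
  simp only [map_add, map_sub, add_apply, sub_apply, app, hP.2]
  rw [h.symm x (P.nabla h x (Z x) (X x))]
  ring

theorem psi_eq (hP : P.IsAlmostProductRiemannian h)
    {X Y Z : Π x : M, TangentSpace 𝓘(ℝ, E) x} {x : M}
    (hX : MDiffAt (T% X) x) (hY : MDiffAt (T% Y) x) (hZ : MDiffAt (T% Z) x) :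
    P.psi h X Y Z x = 2 * h.inner x (P.nabla h x (Y x) (X x)) (Z x) := by
  rw [psi, tachibana_eq hP hX hY hZ, tachibana_eq hP hZ hY hX]
  -- Self-adjointness of `∇_u P` cancels the terms differentiated along `X` and along `Z` in pairs,
  -- while the two along `Y` add up.
  have c (u v w : TangentSpace 𝓘(ℝ, E) x) :
      h.inner x (P.nabla h x u v) w = h.inner x (P.nabla h x u w) v := by
    rw [inner_nabla_comm hP, h.symm]
  rw [c (X x) (Z x), c (Z x) (Y x), c (Y x) (Z x)]
  ring

theorem nijenhuis_eq {X Y : Π x : M, TangentSpace 𝓘(ℝ, E) x} {x : M}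
    (hX : MDiffAt (T% X) x) (hY : MDiffAt (T% Y) x) :
    P.nijenhuis X Y x = P.nabla h x (P.toEnd x (X x)) (Y x) - P.nabla h x (P.toEnd x (Y x)) (X x)
      + P.toEnd x (P.nabla h x (Y x) (X x)) - P.toEnd x (P.nabla h x (X x) (Y x)) := by
  have hPX := P.mdifferentiableAt_app hX
  have hPY := P.mdifferentiableAt_app hY
  have e1 := P.nabla_apply h (P.app X) hY
  have e2 := P.nabla_apply h (P.app Y) hX
  simp only [app] at e1 e2
  rw [nijenhuis, ← h.leviCivita_sub_swap hX hY, ← h.leviCivita_sub_swap hPX hPY,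
    ← h.leviCivita_sub_swap hPX hY, ← h.leviCivita_sub_swap hX hPY, e1, e2,
    P.nabla_apply h X hY, P.nabla_apply h Y hX]
  simp only [map_sub, P.toEnd_toEnd, app]
  abel

/-- A locally decomposable product Riemannian structure is parallel. -/
theorem nabla_eq_zero (hP : P.IsLocallyDecomposable h) (x : M) (u v : TangentSpace 𝓘(ℝ, E) x) :
    P.nabla h x u v = 0 := by
  have smooth (w : TangentSpace 𝓘(ℝ, E) x) : CMDiffAt ∞ (T% (FiberBundle.extend E w)) x :=
    FiberBundle.contMDiffAt_extend 𝓘(ℝ, E) E w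
  have diff (w : TangentSpace 𝓘(ℝ, E) x) := FiberBundle.mdifferentiableAt_extend 𝓘(ℝ, E) E w
  have e1 (a b : TangentSpace 𝓘(ℝ, E) x) :
      P.nabla h x b a = P.nabla h x a b + P.nabla h x (P.toEnd x a) (P.toEnd x b) := by
    refine h.ext_inner fun w ↦ ?_
    have := hP.2.2 x _ _ _ (smooth a) (smooth b) (smooth w)
    rw [psi_eq hP.1 (diff a) (diff b) (diff w), psi_eq hP.1 (diff b) (diff a) (diff w),
      psi_eq hP.1 (P.mdifferentiableAt_app (diff b)) (P.mdifferentiableAt_app (diff a))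
        (diff w)] at this
    simp only [FiberBundle.extend_apply_self, app] at this
    simp only [map_add, add_apply]
    linarith
  have e2 (a b : TangentSpace 𝓘(ℝ, E) x) := hP.2.1 x _ _ (smooth a) (smooth b)
  simp only [nijenhuis_eq (h := h) (diff _) (diff _), FiberBundle.extend_apply_self] at e2
  -- Since `∇P` anticommutes with `P`, applying `P` to `e1` gives `P(∇_b P)a = P(∇_a P)b - (∇_{Pa}
  -- P)b`. Substituted into the vanishing Nijenhuis tensor, this leaves only `-(∇_{Pb} P)a`.
  have e3 (a b : TangentSpace 𝓘(ℝ, E) x) : P.nabla h x (P.toEnd x b) a = 0 := by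
    have h1 := e1 a b
    rw [nabla_toEnd] at h1
    have h2 := congrArg (P.toEnd x) h1
    simp only [map_add, map_neg, P.toEnd_toEnd] at h2
    have h3 := e2 a b
    rw [h2] at h3
    have : P.nabla h x (P.toEnd x b) a = -0 := by
      rw [← h3]
      abel
    simpa using this
  simpa [P.toEnd_toEnd] using e3 v (P.toEnd x u)

end AlmostProductStructure

/-! ### Tracing the differentiated paraholomorphy relation. -/

section tension

theorem eq_zero_of_eq_neg_self {W : Type*} [AddCommGroup W] [Module ℝ W] {w : W} (hw : w = -w) :
    w = 0 := by
  have h2 : (2 : ℝ) • w = 0 := by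
    rw [two_smul]
    nth_rewrite 2 [hw]
    exact add_neg_cancel w
  exact (smul_eq_zero.1 h2).resolve_left two_ne_zero

variable {F : M → N} {P : AlmostProductStructure E M} {h : SemiRiemannianMetric E M}
  {Q : AlmostProductStructure E' N} {g : SemiRiemannianMetric E' N} {x : M}

/-- The second fundamental form at a point, as a bilinear map. -/
def secondFundamentalFormAt (h : SemiRiemannianMetric E M) (g : SemiRiemannianMetric E' N)
    (hF : ContMDiff 𝓘(ℝ, E) 𝓘(ℝ, E') ∞ F) (x : M) :
    TangentSpace 𝓘(ℝ, E) x →ₗ[ℝ] TangentSpace 𝓘(ℝ, E) x →ₗ[ℝ] TangentSpace 𝓘(ℝ, E') (F x) :=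
  LinearMap.mk₂ ℝ
    (fun u v ↦ secondFundamentalForm h g F (FiberBundle.extend E u) (FiberBundle.extend E v) x)
    -- The first field enters only through its value at `x`, so linearity in it is immediate;
    -- linearity in the second needs tensoriality.
    (fun u u' v ↦ by
      simp only [secondFundamentalForm, covDerivAlong, FiberBundle.extend_apply_self, map_add]
      abel)
    (fun c u v ↦ by
      simp only [secondFundamentalForm, covDerivAlong, FiberBundle.extend_apply_self, map_smul]
      module)
    (fun u v v' ↦ (TensorialAt.mkHom _ x (tensorial_secondFundamentalForm h g hF x u)).map_add v v')
    (fun c u v ↦ (TensorialAt.mkHom _ x (tensorial_secondFundamentalForm h g hF x u)).map_smul c v)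

/-- `Q.nabla` as a bilinear map. -/
def AlmostProductStructure.nablaBilin (Q : AlmostProductStructure E' N)
    (g : SemiRiemannianMetric E' N) (y : N) :
    TangentSpace 𝓘(ℝ, E') y →ₗ[ℝ] TangentSpace 𝓘(ℝ, E') y →ₗ[ℝ] TangentSpace 𝓘(ℝ, E') y :=
  LinearMap.mk₂ ℝ (Q.nabla g y) (by simp [nabla]) (by simp [nabla]) (by simp [nabla])
    (by simp [nabla])

/-- The Leibniz rules for `Q` along `F` and for `P` on `M`, applied to the relation `F_*(PY) = ε Q
F_* Y`. A scalar `ε` treats both signs at once. -/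
theorem secondFundamentalFormAt_toEnd (hF : ContMDiff 𝓘(ℝ, E) 𝓘(ℝ, E') ∞ F) {ε : ℝ}
    (hPQ : ∀ (x : M) (u : TangentSpace 𝓘(ℝ, E) x), mfderiv 𝓘(ℝ, E) 𝓘(ℝ, E') F x (P.toEnd x u)
      = ε • Q.toEnd (F x) (mfderiv 𝓘(ℝ, E) 𝓘(ℝ, E') F x u))
    (u v : TangentSpace 𝓘(ℝ, E) x) :
    secondFundamentalFormAt h g hF x u (P.toEnd x v)
      = ε • Q.nabla g (F x) (mfderiv 𝓘(ℝ, E) 𝓘(ℝ, E') F x u) (mfderiv 𝓘(ℝ, E) 𝓘(ℝ, E') F x v)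
        + ε • Q.toEnd (F x) (secondFundamentalFormAt h g hF x u v)
        - mfderiv 𝓘(ℝ, E) 𝓘(ℝ, E') F x (P.nabla h x u v) := by
  have hv := FiberBundle.mdifferentiableAt_extend 𝓘(ℝ, E) E v
  have hFx : MDifferentiableAt 𝓘(ℝ, E) 𝓘(ℝ, E') F x := hF.mdifferentiable (by simp) x
  have e0 : secondFundamentalFormAt h g hF x u (P.toEnd x v)
      = secondFundamentalForm h g F (FiberBundle.extend E u) (P.app (FiberBundle.extend E v)) x :=
    (tensorial_secondFundamentalForm h g hF x u).pointwise
      (FiberBundle.mdifferentiableAt_extend 𝓘(ℝ, E) E _) (P.mdifferentiableAt_app hv)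
      (by simp [AlmostProductStructure.app])
  have e1 : secondFundamentalFormAt h g hF x u v
      = secondFundamentalForm h g F (FiberBundle.extend E u) (FiberBundle.extend E v) x := rfl
  -- The constant `ε` is moved inside the field so that the right side is `Q` applied to a field
  -- along `F`, as `covDerivAlong_toEnd` requires.
  have e2 : (fun y ↦ mfderiv 𝓘(ℝ, E) 𝓘(ℝ, E') F y (P.app (FiberBundle.extend E v) y))
      = fun y ↦ Q.toEnd (F y) (mfderiv 𝓘(ℝ, E) 𝓘(ℝ, E') F y
          (((fun _ : M ↦ ε) • FiberBundle.extend E v) y)) :=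
    funext fun y ↦ by
      rw [Pi.smul_apply', map_smul, map_smul]
      exact hPQ y _
  have hW := mdifferentiableAt_mfderiv_apply hF hv
  have hW' := mdifferentiableAt_mfderiv_apply hF
    ((mdifferentiableAt_const (I := 𝓘(ℝ, E)) (I' := 𝓘(ℝ, ℝ)) (M := M) (c := ε)).smul_section hv)
  have e3 : (fun y ↦ ε • mfderiv 𝓘(ℝ, E) 𝓘(ℝ, E') F y (FiberBundle.extend E v y))
      = fun y ↦ mfderiv 𝓘(ℝ, E) 𝓘(ℝ, E') F y (((fun _ : M ↦ ε) • FiberBundle.extend E v) y) :=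
    funext fun y ↦ by rw [Pi.smul_apply', map_smul]
  have e4 := P.nabla_apply h (FiberBundle.extend E u) hv
  have e5 := covDerivAlong_toEnd g Q hFx hW' (FiberBundle.extend E u x)
  rw [← e3] at e5
  rw [covDerivAlong_smul g hF.continuous.continuousAt mdifferentiableAt_const hW, mvfderiv_const]
    at e5
  rw [e0, e1]
  simp only [secondFundamentalForm]
  rw [e2, e5]
  simp only [FiberBundle.extend_apply_self] at e4 ⊢
  rw [e4]
  simp only [Pi.smul_apply', FiberBundle.extend_apply_self, map_smul, map_sub, map_add, hPQ]
  have hn : Q.nabla g (F x) (mfderiv 𝓘(ℝ, E) 𝓘(ℝ, E') F x u)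
      (ε • mfderiv 𝓘(ℝ, E) 𝓘(ℝ, E') F x v) = ε • Q.nabla g (F x)
        (mfderiv 𝓘(ℝ, E) 𝓘(ℝ, E') F x u) (mfderiv 𝓘(ℝ, E) 𝓘(ℝ, E') F x v) := by
    simp [AlmostProductStructure.nabla]
  rw [hn]
  simp only [zero_apply, zero_smul, add_zero]
  module

theorem tensionField_eq_zero (hM : P.IsSemiParaKaehler h)
    (hN : Q.IsQuasiParaKaehler g ∨ Q.IsLocallyDecomposable g)
    (hF : ContMDiff 𝓘(ℝ, E) 𝓘(ℝ, E') ∞ F) {ε : ℝ} (hε : ε * ε = 1)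
    (hPQ : ∀ (x : M) (u : TangentSpace 𝓘(ℝ, E) x), mfderiv 𝓘(ℝ, E) 𝓘(ℝ, E') F x (P.toEnd x u)
      = ε • Q.toEnd (F x) (mfderiv 𝓘(ℝ, E) 𝓘(ℝ, E') F x u)) :
    tensionField h g F x = 0 := by
  set B := secondFundamentalFormAt h g hF x
  set T := (mfderiv 𝓘(ℝ, E) 𝓘(ℝ, E') F x).toLinearMap
  set C := (Q.nablaBilin g (F x)).compl₁₂ T T
  have hskew := hM.1 x
  have B_symm (u v) : B u v = B v u := secondFundamentalForm_symm h g hF u v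
  have hTP (u) : T (P.toEnd x u) = ε • Q.toEnd (F x) (T u) := hPQ x u
  have hBP (u v) : B u (P.toEnd x v)
      = ε • C u v + ε • Q.toEnd (F x) (B u v) - T (P.nabla h x u v) :=
    secondFundamentalFormAt_toEnd hF hPQ u v
  have trB : h.trace x (fun u v ↦ B u (P.toEnd x v)) = 0 := by
    have e := h.trace_skew B (P.toEnd x).toLinearMap hskew
    have e' := h.trace_swap fun u v ↦ B u (P.toEnd x v)
    simp only [ContinuousLinearMap.coe_coe] at e
    simp only [B_symm _ (P.toEnd x _)] at e e'
    rw [e'] at e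
    simp only [B_symm _ (P.toEnd x _)]
    exact eq_zero_of_eq_neg_self e
  have trC : h.trace x (fun u v ↦ C u v) = 0 := by
    rcases hN with hN | hN
    · have hCP (u v) : C (P.toEnd x u) (P.toEnd x v) = C u v := by
        change Q.nabla g (F x) (T (P.toEnd x u)) (T (P.toEnd x v)) = Q.nabla g (F x) (T u) (T v)
        rw [hTP, hTP]
        have h1 : Q.nabla g (F x) (ε • Q.toEnd (F x) (T u)) (ε • Q.toEnd (F x) (T v))
            = (ε * ε) • Q.nabla g (F x) (Q.toEnd (F x) (T u)) (Q.toEnd (F x) (T v)) := by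
          simp [AlmostProductStructure.nabla, smul_smul]
        rw [h1, hε, one_smul, AlmostProductStructure.nabla_toEnd]
        exact (eq_neg_of_add_eq_zero_left (hN.2 _ _ _)).symm
      -- For the form `C(P·, ·)`, moving `P` across gives `tr C(P·, P·) = -tr C(P²·, ·)`, that is,
      -- `tr C = -tr C`.
      have e := h.trace_skew (C.comp (P.toEnd x).toLinearMap) (P.toEnd x).toLinearMap hskew
      simp only [LinearMap.comp_apply, ContinuousLinearMap.coe_coe, hCP, P.toEnd_toEnd] at e
      exact eq_zero_of_eq_neg_self e
    · have hC0 (u v) : C u v = 0 := Q.nabla_eq_zero hN _ _ _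
      simp [hC0, SemiRiemannianMetric.trace_eq]
  have key : h.trace x (fun u v ↦ B u (P.toEnd x v))
      = ε • h.trace x (fun u v ↦ C u v) + ε • Q.toEnd (F x) (h.trace x fun u v ↦ B u v)
        - T (P.div h x) := by
    have e1 := h.map_trace (Q.toEnd (F x)).toLinearMap fun u v ↦ B u v
    have e2 := h.map_trace T (P.nabla h x)
    simp only [ContinuousLinearMap.coe_coe] at e1
    rw [AlmostProductStructure.div, e1, e2]
    simp only [hBP]
    simp only [SemiRiemannianMetric.trace_eq, Finset.smul_sum, ← Finset.sum_add_distrib,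
      ← Finset.sum_sub_distrib]
    refine Finset.sum_congr rfl fun i _ ↦ Finset.sum_congr rfl fun j _ ↦ ?_
    module
  rw [trB, trC, hM.2 x, smul_zero, map_zero, zero_add, sub_zero] at key
  -- The map `ε Q` is its own inverse, because `ε² = 1` and `Q² = I`.
  have h2 := congrArg (fun w ↦ Q.toEnd (F x) (ε • w)) key
  simp only [smul_smul, hε, one_smul, Q.toEnd_toEnd, smul_zero, map_zero] at h2
  exact h2.symm

end tension

end Harmonic

theorem mainTheorem5
    {E : Type*} [NormedAddCommGroup E] [NormedSpace ℝ E] [FiniteDimensional ℝ E]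
    {M : Type*} [TopologicalSpace M] [ChartedSpace E M] [IsManifold 𝓘(ℝ, E) ∞ M]
    {E' : Type*} [NormedAddCommGroup E'] [NormedSpace ℝ E'] [FiniteDimensional ℝ E']
    {N : Type*} [TopologicalSpace N] [ChartedSpace E' N] [IsManifold 𝓘(ℝ, E') ∞ N]
    (h : SemiRiemannianMetric E M) (P : AlmostProductStructure E M)
    (g : SemiRiemannianMetric E' N) (Q : AlmostProductStructure E' N)
    (hM : P.IsSemiParaKaehler h)
    (hN : Q.IsQuasiParaKaehler g ∨ Q.IsLocallyDecomposable g)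
    (F : M → N) (hF : ContMDiff 𝓘(ℝ, E) 𝓘(ℝ, E') ∞ F)
    (hPQ : IsParaholomorphic P Q F ∨ IsAntiParaholomorphic P Q F) :
    IsHarmonic h g F := by
  refine ⟨hF, fun x ↦ ?_⟩
  rcases hPQ with hPQ | hPQ
  · exact tensionField_eq_zero hM hN hF (ε := 1) (by norm_num) fun x u ↦ by
      rw [one_smul]
      exact hPQ x u
  · exact tensionField_eq_zero hM hN hF (ε := -1) (by norm_num) fun x u ↦ by
      rw [neg_one_smul]
      exact hPQ x u
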